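/- All Banach spaces are over the same scalar field, $\mathbb{R}$ or $\mathbb{C}$. A Banach space $Y$ is finitely representable in a Banach space $W$ if for every $\varepsilon>0$ and every finite-dimensional subspace $A$ of $Y$ there are a subspace $B$ of $W$ and an isomorphism $u:A\to B$ with $\|u\|\,\|u^{-1}\|\le 1+\varepsilon$. For a Banach space $X$, let $X^{f}$ be the class of all Banach spaces $W$ such that each of $X$ and $W$ is finitely representable in the other. A Banach space $Z$ is algebraically closed in $X^{f}$, written $Z\in\mathcal{A}(X^{f})$, if for every $W\in X^{f}$ and every isometric embedding $i:Z\to W$ there is a projection of norm one from $W^{**}$ onto $i^{**}(Z^{**})$, where $i^{**}:Z^{**}\to W^{**}$ is the double adjoint of $i$. A Banach space $Z$ has the identity extension property in $X^{f}$, written $Z\in IEP(X^{f})$, if for every $W\in X^{f}$ and every isometric embedding $j:Z\to W$ there is a bounded linear operator $T:W\to Z^{**}$ with $\|T\|=1$ and $T\circ j=k_Z$, where $k_Z:Z\to Z^{**}$ is the canonical embedding (that is, the identity of $Z$ extends to an operator $W\to Z^{**}$ of norm one). Theorem. Let $X$ and $Z$ be Banach spaces. If $Z\in\mathcal{A}(X^{f})$,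 then $Z\in IEP(X^{f})$. -/

import Mathlib

set_option maxSynthPendingDepth 3

universe u

namespace BanachClass

/-- The double adjoint `u** : E** → F**` of a bounded operator `u : E → F`,
`(u** φ) f = φ (f ∘ u)`. -/
noncomputable def doubleAdjoint {𝕜 E F : Type*} [RCLike 𝕜]
    [NormedAddCommGroup E] [NormedSpace 𝕜 E] [NormedAddCommGroup F] [NormedSpace 𝕜 F]
    (u : E →L[𝕜] F) :
    StrongDual 𝕜 (StrongDual 𝕜 E) →L[𝕜] StrongDual 𝕜 (StrongDual 𝕜 F) :=
  ContinuousLinearMap.precomp 𝕜 (ContinuousLinearMap.precomp 𝕜 u)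

/-- `X` is finitely representable in `Y`: every finite-dimensional subspace of `X` is, for every
`ε > 0`, `(1 + ε)`-isomorphic to a subspace of `Y`. -/
def FinitelyRepresentable (𝕜 X Y : Type*) [RCLike 𝕜]
    [NormedAddCommGroup X] [NormedSpace 𝕜 X] [NormedAddCommGroup Y] [NormedSpace 𝕜 Y] : Prop :=
  ∀ ε : ℝ, 0 < ε → ∀ A : Submodule 𝕜 X, FiniteDimensional 𝕜 A →
    ∃ (B : Submodule 𝕜 Y) (u : A ≃L[𝕜] B),
      ‖(u : A →L[𝕜] B)‖ * ‖(u.symm : B →L[𝕜] A)‖ ≤ 1 + ε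

/-- `X` and `Y` are finitely equivalent. For Banach spaces this says that `Y` belongs to
the class `X^f`. -/
def FinitelyEquivalent (𝕜 X Y : Type*) [RCLike 𝕜]
    [NormedAddCommGroup X] [NormedSpace 𝕜 X] [NormedAddCommGroup Y] [NormedSpace 𝕜 Y] : Prop :=
  FinitelyRepresentable 𝕜 X Y ∧ FinitelyRepresentable 𝕜 Y X

/-- The subspace `M` of `V` is the range of a projection `P : V → V` of norm one. -/
def NormOneComplemented {𝕜 V : Type*} [RCLike 𝕜] [NormedAddCommGroup V] [NormedSpace 𝕜 V]
    (M : Submodule 𝕜 V) : Prop :=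
  ∃ P : V →L[𝕜] V, P.comp P = P ∧ P.range = M ∧ ‖P‖ = 1



/-- `E` is algebraically closed in the class `X^f`: for every Banach space `W` in `X^f` and every
isometric embedding `i : E → W`, the double adjoint `i** : E** → W**` maps `E**` onto a norm one
complemented subspace of `W**`. -/
def AlgebraicallyClosed (𝕜 : Type*) (X E : Type u) [RCLike 𝕜]
    [NormedAddCommGroup X] [NormedSpace 𝕜 X] [NormedAddCommGroup E] [NormedSpace 𝕜 E] : Prop :=
  ∀ (W : Type u) [NormedAddCommGroup W] [NormedSpace 𝕜 W] [CompleteSpace W],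
    FinitelyEquivalent 𝕜 X W → ∀ i : E →ₗᵢ[𝕜] W,
      NormOneComplemented (doubleAdjoint i.toContinuousLinearMap).range

/-- `Z` has the identity extension property in the class `X^f`: for every Banach space `W` in `X^f`
that contains `Z` as a subspace (through an isometric embedding `j : Z → W`), the identity of `Z`,
followed by the canonical embedding `Z → Z**`, extends to an operator `T : W → Z**` of norm one.
(If such a `W` exists then `Z` is automatically finitely representable in `X`.) -/
def IdentityExtensionProperty (𝕜 : Type*) (X Z : Type u) [RCLike 𝕜]
    [NormedAddCommGroup X] [NormedSpace 𝕜 X] [NormedAddCommGroup Z] [NormedSpace 𝕜 Z] : Prop :=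
  ∀ (W : Type u) [NormedAddCommGroup W] [NormedSpace 𝕜 W] [CompleteSpace W],
    FinitelyEquivalent 𝕜 X W → ∀ j : Z →ₗᵢ[𝕜] W,
      ∃ T : W →L[𝕜] StrongDual 𝕜 (StrongDual 𝕜 Z),
        ‖T‖ = 1 ∧ ∀ z : Z, T (j z) = NormedSpace.inclusionInDoubleDual 𝕜 Z z

end BanachClass

/-! Write `k` for canonical embeddings into biduals. Given a norm one projection `P` of `F**` onto
`i**(E**)`, take `T = (i**)⁻¹ ∘ P ∘ k_F`. By Hahn–Banach `i**` is isometric, so its inverse on the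
range costs no norm and `‖T‖ ≤ 1`. Naturality, `k_F ∘ i = i** ∘ k_E`, gives `T ∘ i = k_E`. -/

namespace BanachClass

section

variable {𝕜 E F : Type*} [RCLike 𝕜]
  [NormedAddCommGroup E] [NormedSpace 𝕜 E] [NormedAddCommGroup F] [NormedSpace 𝕜 F]

/-- Hahn–Banach extension of a functional along an isometric embedding. -/
theorem exists_comp_eq_norm_eq (i : E →ₗᵢ[𝕜] F) (f : StrongDual 𝕜 E) :
    ∃ g : StrongDual 𝕜 F, g.comp i.toContinuousLinearMap = f ∧ ‖g‖ = ‖f‖ := by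
  let e := i.equivRange
  obtain ⟨g, hg, hgn⟩ := exists_extension_norm_eq (LinearMap.range i.toLinearMap)
    (f.comp (e.symm.toContinuousLinearEquiv : _ →L[𝕜] E))
  refine ⟨g, ?_, ?_⟩
  · ext x
    have h := hg (e x)
    simpa [e] using h
  · rw [hgn]
    exact f.opNorm_comp_linearIsometryEquiv e.symm

/-- For the lower bound, every functional on `E` is `g ∘ i` with `g` of the same norm, so testing
`i** φ` on such `g` loses nothing. -/
theorem norm_doubleAdjoint_apply (i : E →ₗᵢ[𝕜] F) (φ : StrongDual 𝕜 (StrongDual 𝕜 E)) :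
    ‖doubleAdjoint i.toContinuousLinearMap φ‖ = ‖φ‖ := by
  apply le_antisymm
  · refine ContinuousLinearMap.opNorm_le_bound _ (norm_nonneg _) fun f => ?_
    refine (φ.le_opNorm _).trans (mul_le_mul_of_nonneg_left ?_ (norm_nonneg _))
    refine ContinuousLinearMap.opNorm_le_bound _ (norm_nonneg _) fun x => ?_
    simpa using f.le_opNorm (i x)
  · refine ContinuousLinearMap.opNorm_le_bound _ (norm_nonneg _) fun f => ?_
    obtain ⟨g, rfl, hg⟩ := exists_comp_eq_norm_eq i f
    rw [← hg]
    exact (doubleAdjoint i.toContinuousLinearMap φ).le_opNorm g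

/-- The double adjoint of an isometric embedding, as an isometric embedding. -/
noncomputable def doubleAdjointIsometry (i : E →ₗᵢ[𝕜] F) :
    StrongDual 𝕜 (StrongDual 𝕜 E) →ₗᵢ[𝕜] StrongDual 𝕜 (StrongDual 𝕜 F) where
  toLinearMap := (doubleAdjoint i.toContinuousLinearMap).toLinearMap
  norm_map' := norm_doubleAdjoint_apply i

/-- If the bidual of `E` is norm one complemented in the bidual of `F`, then the canonical embedding
of `E` extends to an operator of norm one on `F`. -/
theorem NormOneComplemented.exists_extension {i : E →ₗᵢ[𝕜] F}
    (h : NormOneComplemented (doubleAdjoint i.toContinuousLinearMap).range) :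
    ∃ T : F →L[𝕜] StrongDual 𝕜 (StrongDual 𝕜 E),
      ‖T‖ = 1 ∧ ∀ x : E, T (i x) = NormedSpace.inclusionInDoubleDual 𝕜 E x := by
  obtain ⟨P, hPP, hrange, hP⟩ := h
  have hmem (ψ) : P ψ ∈ LinearMap.range (doubleAdjointIsometry i).toLinearMap := by
    have : P ψ ∈ P.range := ⟨ψ, rfl⟩
    rwa [hrange] at this
  have hfix (φ) : P (doubleAdjoint i.toContinuousLinearMap φ) =
      doubleAdjoint i.toContinuousLinearMap φ := by
    have : doubleAdjoint i.toContinuousLinearMap φ ∈ P.range := hrange ▸ ⟨φ, rfl⟩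
    obtain ⟨ψ, hψ⟩ := this
    rw [← hψ]
    exact DFunLike.congr_fun hPP ψ
  let e := (doubleAdjointIsometry i).equivRange
  let T : F →L[𝕜] StrongDual 𝕜 (StrongDual 𝕜 E) :=
    (e.symm.toContinuousLinearEquiv : _ →L[𝕜] _).comp
      ((P.codRestrict _ hmem).comp (NormedSpace.inclusionInDoubleDual 𝕜 F))
  have hT (x : E) : T (i x) = NormedSpace.inclusionInDoubleDual 𝕜 E x := by
    refine (e.symm_apply_eq).2 (Subtype.ext ?_)
    -- Naturality of `k` holds by definition here.
    exact hfix (NormedSpace.inclusionInDoubleDual 𝕜 E x)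
  refine ⟨T, le_antisymm ?_ ?_, hT⟩
  · refine ContinuousLinearMap.opNorm_le_bound _ zero_le_one fun w => ?_
    calc ‖T w‖ = ‖P (NormedSpace.inclusionInDoubleDual 𝕜 F w)‖ := e.symm.norm_map _
      _ ≤ ‖P‖ * ‖NormedSpace.inclusionInDoubleDual 𝕜 F w‖ := P.le_opNorm _
      _ ≤ 1 * ‖w‖ := by
        rw [hP]
        exact mul_le_mul_of_nonneg_left (NormedSpace.double_dual_bound 𝕜 F w) zero_le_one
  -- The lower bound needs a nonzero vector; if `E` were zero, `P` would vanish, against `‖P‖ = 1`.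
  · have hE : Nontrivial E := by
      by_contra hE
      rw [not_nontrivial_iff_subsingleton] at hE
      have hP0 : P = 0 := by
        ext1 ψ
        obtain ⟨φ, hφ⟩ := hmem ψ
        rw [← hφ, Subsingleton.elim φ 0]
        simp
      simp [hP0] at hP
    obtain ⟨x, hx⟩ := exists_ne (0 : E)
    have h := T.le_opNorm (i x)
    have hk : ‖NormedSpace.inclusionInDoubleDual 𝕜 E x‖ = ‖x‖ :=
      (NormedSpace.inclusionInDoubleDualLi 𝕜).norm_map x
    rw [hT, hk, i.norm_map] at h
    exact (le_mul_iff_one_le_left (norm_pos_iff.2 hx)).1 h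

end

end BanachClass

theorem theorem4 {𝕜 : Type*} [RCLike 𝕜] (X Z : Type u)
    [NormedAddCommGroup X] [NormedSpace 𝕜 X] [CompleteSpace X]
    [NormedAddCommGroup Z] [NormedSpace 𝕜 Z] [CompleteSpace Z]
    (hZ : BanachClass.AlgebraicallyClosed 𝕜 X Z) :
    BanachClass.IdentityExtensionProperty 𝕜 X Z := by
  intro W _ _ _ hW j
  exact (hZ W hW j).exists_extension
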